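/- Consider the linear system $x_{t+1}=Ax_t+Bu_t+Gw_t$ with $x_t\in\mathbb R^n$, $u_t\in\mathbb R^m$, $w_t\in\mathcal W\subset\mathbb R^q$, state constraint set $\mathcal X$, input constraint set $\mathcal U$, and $\mathcal W$ bounded with $0\in\mathcal W$. Call the origin ISS with region of attraction $\mathcal X_0$ ($0\in\mathcal X_0$) for a system with disturbance input $d_t$ if there are $\beta\in\mathcal{KL}$ and $\gamma\in\mathcal K$ such that $\|x_t\|\le\beta(\|x_0\|,t)+\gamma(\max_{k<t}\|d_k\|)$ for all $t$ and all trajectories with $x_0\in\mathcal X_0$. Backup MPC. Let a backup optimal control problem with horizon $N_b\ge1$ and cost $J^b$ (its constraints are arbitrary) be given, and let $\kappa_b(x)$ be the first element of its optimal input sequence at $x$. Assume that for the backup closed loop $x_{t+1}=Ax_t+B\kappa_b(x_t)+Gw_t$, $w_t\in\mathcal W$, started in $\mathcal X_0$, the problem is recursively feasible and $x_t\in\mathcal X$, $\kappa_b(x_t)\in\mathcal U$ for all $t$; that $\mathcal X_0$ is robust positively invariant; and that the origin is ISS with respect to $w_t$ with region of attraction $\mathcal X_0$. Assume further that $\mathcal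 X_0$ is bounded and that $\kappa_b$ is uniformly continuous on $\mathcal X_0$. Backup cost. $J^b(x_t,U)=\sum_{k=0}^{N_b-1}\big(\bar x_{t+k|t}^\top Q\bar x_{t+k|t}+u_{t+k|t}^\top Ru_{t+k|t}\big)+V_f(\bar x_{t+N_b|t})$, where $\bar x$ are the nominal ($w=0$) predicted states, $Q$ and $R$ are symmetric positive definite, and $V_f$ is a Lyapunov function for $x_{t+1}=(A+BK)x_t$, with $K$ stabilizing, in a terminal set $\mathcal X_f\ni0$: $V_f$ is continuous on $\mathcal X_f$ and positive definite there, and $V_f((A+BK)x)-V_f(x)\le-x^\top(Q+K^\top RK)x$ for all $x\in\mathcal X_f$. Safe SMPC algorithm. Let a stochastic MPC problem with horizon $N\ge1$ be given: minimize an arbitrary cost $J(x_t,U)$ subject to $u_{t+k|t}\in\mathcal U$ and the chance constraints $\Pr(x_{t+k|t}\in\mathcal X)\ge p$, $k=1,\dots,N$ (exact, or in any reformulation). At each time $t$, if this problem has an optimal sequence, one of them, $(u^{s*}_{t|t},\dots)$, is computed. If it exists and $Ax_t+Bu^{s*}_{t|t}\in\mathcal X_0\ominus G\mathcal W$, then $u_t=u^{s*}_{t|t}$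 is applied; otherwise $u_t=\kappa_b(x_t)$ is applied. Then, for every closed-loop trajectory under this algorithm with $w_t\in\mathcal W$ and $x_0\in\mathcal X_0$, one has $x_t\in\mathcal X_0$ for all $t$, and the origin of the closed loop is ISS with region of attraction $\mathcal X_0$ with respect to the extended disturbance $w'_t=(\tilde u_t,w_t)$, where $\tilde u_t=\kappa_b(x_t)-u_t$ is the gap between the backup input and the applied input. -/

import Mathlib

open MeasureTheory Filter Topology

namespace SafeSMPC

/-- Column vectors of length `n` with the Euclidean norm. -/
abbrev Vec (n : ℕ) : Type := EuclideanSpace ℝ (Fin n)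

/-! ### Comparison functions and input-to-state stability -/

/-- Class `𝒦` functions on `[0, ∞)`. -/
structure IsClassK (γ : ℝ → ℝ) : Prop where
  continuousOn : ContinuousOn γ (Set.Ici 0)
  strictMonoOn : StrictMonoOn γ (Set.Ici 0)
  map_zero : γ 0 = 0

/-- Class `𝒦ℒ` functions on `[0, ∞) × ℕ` (discrete time). -/
structure IsClassKL (β : ℝ → ℕ → ℝ) : Prop where
  classK : ∀ t, IsClassK fun s => β s t
  antitone : ∀ s, 0 ≤ s → Antitone (β s)
  tendsto : ∀ s, 0 ≤ s → Tendsto (β s) atTop (𝓝 0)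

/-- The origin is input-to-state stable with region of attraction `X₀`, for a system given by the
set `T` of its pairs (state trajectory, disturbance sequence):
`‖x_t‖ ≤ β(‖x_0‖, t) + γ(max_{k < t} ‖d_k‖)` for all trajectories that start in `X₀`. -/
def IsISS {E D : Type*} [NormedAddCommGroup E] [NormedAddCommGroup D]
    (X₀ : Set E) (T : Set ((ℕ → E) × (ℕ → D))) : Prop :=
  (0 : E) ∈ X₀ ∧ ∃ (β : ℝ → ℕ → ℝ) (γ : ℝ → ℝ), IsClassKL β ∧ IsClassK γ ∧
    ∀ (x : ℕ → E) (d : ℕ → D), (x, d) ∈ T → x 0 ∈ X₀ → ∀ t,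
      ‖x t‖ ≤ β ‖x 0‖ t + γ (((Finset.range t).sup fun k => ‖d k‖₊ : NNReal) : ℝ)

/-- Pontryagin difference `S ⊖ T`. -/
def pontryaginDiff {E : Type*} [Add E] (S T : Set E) : Set E := {z | ∀ y ∈ T, z + y ∈ S}

/-! ### The system -/

/-- The linear system `x⁺ = A x + B u + G w`. -/
structure LinSys (n m q : ℕ) where
  A : Matrix (Fin n) (Fin n) ℝ
  B : Matrix (Fin n) (Fin m) ℝ
  G : Matrix (Fin n) (Fin q) ℝ

namespace LinSys

variable {n m q : ℕ}

/-- One step of the system. -/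
noncomputable def step (S : LinSys n m q) (x : Vec n) (u : Vec m) (w : Vec q) : Vec n :=
  S.A.toEuclideanLin x + S.B.toEuclideanLin u + S.G.toEuclideanLin w

/-- One step of the nominal system `A x + B u`. -/
noncomputable def nominal (S : LinSys n m q) (x : Vec n) (u : Vec m) : Vec n :=
  S.A.toEuclideanLin x + S.B.toEuclideanLin u

/-- Predicted states `x_{t|t}, …, x_{t+N|t}` for an input sequence `V` and uncertainties `w`. -/
noncomputable def predict (S : LinSys n m q) {N : ℕ} (x : Vec n) (V : Fin N → Vec m)
    (w : Fin N → Vec q) : Fin (N + 1) → Vec n :=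
  Fin.induction (motive := fun _ => Vec n) x (fun k xk => S.step xk (V k) (w k))

end LinSys

/-- The weighted square `‖x‖²_Q = xᵀ Q x`. -/
noncomputable def wsq {n : ℕ} (Q : Matrix (Fin n) (Fin n) ℝ) (x : Vec n) : ℝ :=
  inner ℝ x (Q.toEuclideanLin x)

/-! ### The stochastic MPC -/

/-- How the chance constraints `Pr(x_{t+k|t} ∈ X) ≥ p`, `k = 1, …, N`, enter the stochastic MPC
problem: exactly, for a law of the predicted uncertainties, or through an arbitrary
reformulation, i.e. an arbitrary set of admissible pairs of a state and an input sequence. -/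
inductive ChanceForm (n m q N : ℕ) where
  | exact (law : ProbabilityMeasure (Fin N → Vec q)) (p : ℝ)
  | reformulated (C : Set (Vec n × (Fin N → Vec m)))

/-- The chance constraints hold for the state `x` and the input sequence `V`. -/
def ChanceForm.Holds {n m q N : ℕ} (S : LinSys n m q) (X : Set (Vec n)) :
    ChanceForm n m q N → Vec n → (Fin N → Vec m) → Prop
  | .exact law p, x, V =>
      ∀ k : Fin N, p ≤ (law : Measure (Fin N → Vec q)).real {w | S.predict x V w k.succ ∈ X}
  | .reformulated C, x, V => (x, V) ∈ C

/-- Data of the stochastic MPC problem: horizon, (arbitrary) cost, chance constraints. -/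
structure SMPC (n m q : ℕ) where
  N : ℕ
  N_pos : 0 < N
  J : Vec n → (Fin N → Vec m) → ℝ
  chance : ChanceForm n m q N

namespace SMPC

variable {n m q : ℕ}

def Feasible (P : SMPC n m q) (S : LinSys n m q) (X : Set (Vec n)) (U : Set (Vec m))
    (x : Vec n) (V : Fin P.N → Vec m) : Prop :=
  (∀ k, V k ∈ U) ∧ P.chance.Holds S X x V

/-- `V` is an optimal input sequence of the stochastic MPC problem at the state `x`. -/
def Optimal (P : SMPC n m q) (S : LinSys n m q) (X : Set (Vec n)) (U : Set (Vec m))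
    (x : Vec n) (V : Fin P.N → Vec m) : Prop :=
  P.Feasible S X U x V ∧ ∀ V', P.Feasible S X U x V' → P.J x V ≤ P.J x V'

end SMPC

/-! ### The backup MPC -/

/-- The backup MPC: an optimal control problem with an arbitrary constraint set `feas x` for the
input sequences at the state `x`, together with a choice `sol x` of an optimal input sequence at
every state where there is one. -/
structure BackupMPC (n m : ℕ) where
  N : ℕ
  N_pos : 0 < N
  J : Vec n → (Fin N → Vec m) → ℝ
  feas : Vec n → Set (Fin N → Vec m)
  sol : Vec n → (Fin N → Vec m)
  sol_optimal : ∀ x, (∃ V ∈ feas x, ∀ V' ∈ feas x, J x V ≤ J x V') →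
    sol x ∈ feas x ∧ ∀ V' ∈ feas x, J x (sol x) ≤ J x V'

namespace BackupMPC

variable {n m q : ℕ}

/-- The backup problem has an optimal solution at `x`. -/
def Solvable (b : BackupMPC n m) (x : Vec n) : Prop :=
  ∃ V ∈ b.feas x, ∀ V' ∈ b.feas x, b.J x V ≤ b.J x V'

/-- The backup control law: the first element of the optimal input sequence. -/
def law (b : BackupMPC n m) (x : Vec n) : Vec m := b.sol x ⟨0, b.N_pos⟩

/-- Trajectories of the backup closed loop `x⁺ = f(x, κ(x), w)`, with disturbances in `W`. -/
def closedLoop (b : BackupMPC n m) (S : LinSys n m q) (W : Set (Vec q)) :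
    Set ((ℕ → Vec n) × (ℕ → Vec q)) :=
  {xw | ∀ t, xw.2 t ∈ W ∧ xw.1 (t + 1) = S.step (xw.1 t) (b.law (xw.1 t)) (xw.2 t)}

/-- The requirements on the backup MPC: from `X₀` it is recursively feasible and satisfies the
state and input constraints at all times, `X₀` is robust positively invariant, and the origin of
the backup closed loop is ISS with region of attraction `X₀`. -/
structure Admissible (b : BackupMPC n m) (S : LinSys n m q) (X : Set (Vec n)) (U : Set (Vec m))
    (W : Set (Vec q)) (X₀ : Set (Vec n)) : Prop where
  recursivelyFeasible : ∀ x w, (x, w) ∈ b.closedLoop S W → x 0 ∈ X₀ → ∀ t, b.Solvable (x t)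
  constraints : ∀ x w, (x, w) ∈ b.closedLoop S W → x 0 ∈ X₀ → ∀ t, x t ∈ X ∧ b.law (x t) ∈ U
  invariant : ∀ x ∈ X₀, ∀ w ∈ W, S.step x (b.law x) w ∈ X₀
  iss : IsISS X₀ (b.closedLoop S W)

/-- The cost is a sum of quadratic stage costs `‖x̄_k‖²_Q + ‖u_k‖²_R` along the nominal prediction
plus the terminal cost of the last nominal state. -/
def HasQuadraticCost (b : BackupMPC n m) (S : LinSys n m q) (Q : Matrix (Fin n) (Fin n) ℝ)
    (R : Matrix (Fin m) (Fin m) ℝ) (Vf : Vec n → ℝ) : Prop :=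
  ∀ x V, b.J x V =
    (∑ k : Fin b.N, (wsq Q (S.predict x V 0 k.castSucc) + wsq R (V k)))
      + Vf (S.predict x V 0 (Fin.last b.N))

end BackupMPC

/-- `K` is stabilizing: all eigenvalues of `A + B K` lie in the open unit disc. -/
def IsStabilizing {n m q : ℕ} (S : LinSys n m q) (K : Matrix (Fin m) (Fin n) ℝ) : Prop :=
  ∀ z ∈ spectrum ℂ ((S.A + S.B * K).map (algebraMap ℝ ℂ)), ‖z‖ < 1

/-- `Vf` is a Lyapunov function for `x⁺ = (A + B K) x` in the terminal set `Xf`, with decrease at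
least `xᵀ (Q + Kᵀ R K) x`. -/
structure IsTerminalLyapunov {n m q : ℕ} (S : LinSys n m q) (Q : Matrix (Fin n) (Fin n) ℝ)
    (R : Matrix (Fin m) (Fin m) ℝ) (K : Matrix (Fin m) (Fin n) ℝ) (Xf : Set (Vec n))
    (Vf : Vec n → ℝ) : Prop where
  zero_mem : 0 ∈ Xf
  map_zero : Vf 0 = 0
  pos : ∀ x ∈ Xf, x ≠ 0 → 0 < Vf x
  continuousOn : ContinuousOn Vf Xf
  decrease : ∀ x ∈ Xf,
    Vf ((S.A + S.B * K).toEuclideanLin x) - Vf x ≤ - wsq (Q + K.transpose * R * K) x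

/-! ### The safe stochastic MPC algorithm -/

/-- The stochastic input sequence `V` passes the safety test at `x`: the next nominal state lies in
`X₀ ⊖ G W`. -/
def SafeTest {n m q N : ℕ} (S : LinSys n m q) (W : Set (Vec q)) (X₀ : Set (Vec n)) (hN : 0 < N)
    (x : Vec n) (V : Fin N → Vec m) : Prop :=
  S.nominal x (V ⟨0, hN⟩) ∈ pontryaginDiff X₀ (S.G.toEuclideanLin '' W)

/-- The input `u` is one that the switched algorithm applies at the state `x` (if the stochastic
problem has several optimal sequences, any of them may be returned).
Stochastic mode: an optimal stochastic sequence passes the safety test, and its first element is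
applied. Backup mode: there is no optimal stochastic sequence, or the one obtained fails the test,
and the backup law is applied. -/
def SafeInput {n m q : ℕ} (S : LinSys n m q) (X : Set (Vec n)) (U : Set (Vec m))
    (W : Set (Vec q)) (X₀ : Set (Vec n)) (P : SMPC n m q) (b : BackupMPC n m)
    (x : Vec n) (u : Vec m) : Prop :=
  (∃ V, P.Optimal S X U x V ∧ SafeTest S W X₀ P.N_pos x V ∧ u = V ⟨0, P.N_pos⟩) ∨
  (((¬ ∃ V, P.Optimal S X U x V) ∨
      ∃ V, P.Optimal S X U x V ∧ ¬ SafeTest S W X₀ P.N_pos x V) ∧ u = b.law x)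

/-- State, input and disturbance sequences of the closed loop under the switched algorithm. -/
def IsSafeRun {n m q : ℕ} (S : LinSys n m q) (X : Set (Vec n)) (U : Set (Vec m))
    (W : Set (Vec q)) (X₀ : Set (Vec n)) (P : SMPC n m q) (b : BackupMPC n m)
    (x : ℕ → Vec n) (u : ℕ → Vec m) (w : ℕ → Vec q) : Prop :=
  ∀ t, w t ∈ W ∧ SafeInput S X U W X₀ P b (x t) (u t) ∧ x (t + 1) = S.step (x t) (u t) (w t)

/-- The extended disturbance `w' = (ũ, w)`, with `ũ = κ(x) - u` the gap between the backup input
and the applied input, under the Euclidean norm. -/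
noncomputable def extDist {n m q : ℕ} (b : BackupMPC n m) (x : ℕ → Vec n) (u : ℕ → Vec m)
    (w : ℕ → Vec q) : ℕ → WithLp 2 (Vec m × Vec q) :=
  fun t => WithLp.toLp 2 (b.law (x t) - u t, w t)

/-- The closed loop under the switched algorithm, seen as a system with input `w' = (ũ, w)`. -/
def safeClosedLoop {n m q : ℕ} (S : LinSys n m q) (X : Set (Vec n)) (U : Set (Vec m))
    (W : Set (Vec q)) (X₀ : Set (Vec n)) (P : SMPC n m q) (b : BackupMPC n m) :
    Set ((ℕ → Vec n) × (ℕ → WithLp 2 (Vec m × Vec q))) :=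
  {xd | ∃ u w, IsSafeRun S X U W X₀ P b xd.1 u w ∧ xd.2 = extDist b xd.1 u w}

end SafeSMPC

namespace SafeSMPC

/-! The safety test and the robust invariance under the backup law each keep the next state in `X₀`
for every admissible disturbance. For ISS, the closed loop is read as `x⁺ = F x + e`, where `F` is
the nominal backup loop and `e = G w - B ũ`, so `‖e‖ ≤ C ‖w'‖`. As `0 ∈ W`, the backup ISS estimate
bounds the iterates of `F` by a `𝒦ℒ` function.

It remains to see that this stability is robust (`exists_iss_bound_of_uniformContinuousOn`). Uniform
continuity keeps a perturbed trajectory near the iterates of `F` over a finite horizon. As `X₀` is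
bounded, one horizon `T` contracts all of it to a small ball; restarting at time `t - T` gives
smallness at every `t ≥ T`. The resulting ε-δ statements become an ISS bound through explicit
comparison functions (`exists_comparison_bound`). -/

/-- A trajectory in `X₀` of `x⁺ = F x + e`, with small `e`, follows the iterates of the uniformly
continuous map `F` over a finite horizon. -/
lemma exists_norm_sub_iterate_le {E : Type*} [NormedAddCommGroup E] {X₀ : Set E} {F : E → E}
    (hF : UniformContinuousOn F X₀) (hmaps : Set.MapsTo F X₀ X₀) (T : ℕ) :
    ∀ ε > 0, ∃ δ > 0, ∀ x : ℕ → E, (∀ t, x t ∈ X₀) →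
      ∀ t ≤ T, (∀ k < t, ‖x (k + 1) - F (x k)‖ ≤ δ) → ‖x t - F^[t] (x 0)‖ ≤ ε := by
  induction T with
  | zero =>
    intro ε hε
    refine ⟨1, one_pos, fun x _ t ht _ => ?_⟩
    obtain rfl : t = 0 := by omega
    simpa using hε.le
  | succ T ih =>
    intro ε hε
    obtain ⟨η, hη, hFη⟩ := Metric.uniformContinuousOn_iff.1 hF (ε / 2) (half_pos hε)
    -- The bound `ε` serves the times up to `T`; `η / 2` puts `x T` strictly within the modulus `η`
    -- of its iterate for the last step.
    obtain ⟨δ, hδ, h⟩ := ih (min ε (η / 2)) (lt_min hε (half_pos hη))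
    refine ⟨min δ (ε / 2), lt_min hδ (half_pos hε), fun x hx t ht he => ?_⟩
    rcases Nat.lt_or_ge T t with hTt | hTt
    · obtain rfl : t = T + 1 := by omega
      have h₁ : ‖x T - F^[T] (x 0)‖ ≤ η / 2 :=
        (h x hx T le_rfl fun k hk => (he k (by omega)).trans (min_le_left _ _)).trans
          (min_le_right _ _)
      have h₂ := hFη (x T) (hx T) _ (hmaps.iterate T (hx 0))
        (by rw [dist_eq_norm]; linarith)
      have h₃ := (he T (by omega)).trans (min_le_right _ _)
      rw [dist_eq_norm] at h₂
      rw [Function.iterate_succ_apply']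
      calc _ = ‖(x (T + 1) - F (x T)) + (F (x T) - F (F^[T] (x 0)))‖ := by congr 1; abel
        _ ≤ _ := norm_add_le _ _
        _ ≤ ε := by linarith
    · exact (h x hx t hTt fun k hk => (he k hk).trans (min_le_left _ _)).trans (min_le_left _ _)

/-! ### Comparison functions from ε-δ estimates -/

section Comparison

variable (M : ℝ) (δ : ℕ → ℝ) (c : ℕ → ℝ)

/-- The saturated series `∑ₖ M 2⁻ᵏ min(1, s / δₖ) cₖ`. -/
noncomputable def saturatedSeries (s : ℝ) : ℝ :=
  ∑' k, M * (1 / 2) ^ k * min 1 (s / δ k) * c k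

variable {M δ c}

lemma saturatedTerm_nonneg (hM : 0 ≤ M) (hδ : ∀ k, 0 < δ k) (hc : ∀ k, 0 ≤ c k) {s : ℝ}
    (hs : 0 ≤ s) (k : ℕ) : 0 ≤ M * (1 / 2) ^ k * min 1 (s / δ k) * c k :=
  mul_nonneg (mul_nonneg (by positivity) (le_min zero_le_one (div_nonneg hs (hδ k).le))) (hc k)

lemma norm_saturatedTerm_le (hM : 0 ≤ M) (hδ : ∀ k, 0 < δ k) (hc : ∀ k, 0 ≤ c k)
    (hc₁ : ∀ k, c k ≤ 1) {s : ℝ} (hs : 0 ≤ s) (k : ℕ) :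
    ‖M * (1 / 2) ^ k * min 1 (s / δ k) * c k‖ ≤ M * (1 / 2) ^ k := by
  rw [Real.norm_of_nonneg (saturatedTerm_nonneg hM hδ hc hs k)]
  have h₀ : 0 ≤ min 1 (s / δ k) := le_min zero_le_one (div_nonneg hs (hδ k).le)
  have h₁ : min 1 (s / δ k) * c k ≤ 1 := mul_le_one₀ (min_le_left _ _) (hc k) (hc₁ k)
  rw [mul_assoc]
  exact mul_le_of_le_one_right (by positivity) h₁

lemma summable_mul_half_pow (M : ℝ) : Summable fun k : ℕ => M * (1 / 2 : ℝ) ^ k :=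
  summable_geometric_two.mul_left M

lemma summable_saturatedTerm (hM : 0 ≤ M) (hδ : ∀ k, 0 < δ k) (hc : ∀ k, 0 ≤ c k)
    (hc₁ : ∀ k, c k ≤ 1) {s : ℝ} (hs : 0 ≤ s) :
    Summable fun k => M * (1 / 2) ^ k * min 1 (s / δ k) * c k :=
  (summable_mul_half_pow M).of_norm_bounded (norm_saturatedTerm_le hM hδ hc hc₁ hs)

/-- Continuity comes from uniform domination by a geometric series. The series alone is constant
once every active term saturates, so `s * a` supplies strictness. -/
lemma isClassK_saturatedSeries_add (hM : 0 ≤ M) (hδ : ∀ k, 0 < δ k) (hc : ∀ k, 0 ≤ c k)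
    (hc₁ : ∀ k, c k ≤ 1) {a : ℝ} (ha : 0 < a) :
    IsClassK fun s => saturatedSeries M δ c s + s * a where
  continuousOn := by
    refine ContinuousOn.add ?_ (by fun_prop)
    refine continuousOn_tsum (fun k => ?_) (summable_mul_half_pow M)
      fun k s hs => norm_saturatedTerm_le hM hδ hc hc₁ hs k
    fun_prop
  strictMonoOn := by
    intro s hs s' hs' hss
    refine add_lt_add_of_le_of_lt ?_ (by gcongr)
    refine (summable_saturatedTerm hM hδ hc hc₁ hs).tsum_le_tsum (fun k => ?_)
      (summable_saturatedTerm hM hδ hc hc₁ hs')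
    have := hδ k
    have := hc k
    gcongr
  map_zero := by simp [saturatedSeries]

lemma le_saturatedSeries (hM : 0 ≤ M) (hδ : ∀ k, 0 < δ k) (hc : ∀ k, 0 ≤ c k)
    (hc₁ : ∀ k, c k ≤ 1) {s : ℝ} {k : ℕ} (hs : δ k ≤ s) (hck : c k = 1) :
    M * (1 / 2) ^ k ≤ saturatedSeries M δ c s := by
  have hs₀ : 0 ≤ s := (hδ k).le.trans hs
  have h := (summable_saturatedTerm hM hδ hc hc₁ hs₀).le_tsum k
    fun j _ => saturatedTerm_nonneg hM hδ hc hs₀ j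
  rwa [min_eq_left ((one_le_div (hδ k)).2 hs), hck, mul_one, mul_one] at h

lemma saturatedSeries_nonneg (hM : 0 ≤ M) (hδ : ∀ k, 0 < δ k) (hc : ∀ k, 0 ≤ c k) {s : ℝ}
    (hs : 0 ≤ s) : 0 ≤ saturatedSeries M δ c s :=
  tsum_nonneg (saturatedTerm_nonneg hM hδ hc hs)

/-- The `k`-th term is switched off from time `T k` on: this makes the series antitone in `t`, and
dominated convergence sends it to `0`. -/
lemma isClassKL_saturatedSeries_add (hM : 0 ≤ M) (hδ : ∀ k, 0 < δ k) (T : ℕ → ℕ) :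
    IsClassKL fun s t =>
      saturatedSeries M δ (fun k => if t < T k then 1 else 0) s + s * (1 / 2) ^ t where
  classK t := isClassK_saturatedSeries_add hM hδ (fun k => by split_ifs <;> norm_num)
    (fun k => by split_ifs <;> norm_num) (by positivity)
  antitone s hs t t' htt := by
    have hc : ∀ t k, (0 : ℝ) ≤ if t < T k then 1 else 0 := fun t k => by split_ifs <;> norm_num
    have hc₁ : ∀ t k, (if t < T k then 1 else 0 : ℝ) ≤ 1 := fun t k => by
      split_ifs <;> norm_num
    refine add_le_add ?_ ?_
    · refine (summable_saturatedTerm hM hδ (hc t') (hc₁ t') hs).tsum_le_tsum (fun k => ?_)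
        (summable_saturatedTerm hM hδ (hc t) (hc₁ t) hs)
      have : 0 ≤ min 1 (s / δ k) := le_min zero_le_one (div_nonneg hs (hδ k).le)
      refine mul_le_mul_of_nonneg_left ?_ (by positivity)
      dsimp only
      split_ifs <;> first | omega | norm_num
    · exact mul_le_mul_of_nonneg_left
        (pow_le_pow_of_le_one (by norm_num) (by norm_num) htt) hs
  tendsto s hs := by
    have h₁ : Tendsto (fun t => saturatedSeries M δ (fun k => if t < T k then 1 else 0) s) atTop
        (𝓝 (∑' _ : ℕ, 0)) := by
      refine tendsto_tsum_of_dominated_convergence (summable_mul_half_pow M) (fun k => ?_)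
        (Eventually.of_forall fun t k => norm_saturatedTerm_le
          (c := fun k => if t < T k then 1 else 0) hM hδ
          (fun k => by split_ifs <;> norm_num) (fun k => by split_ifs <;> norm_num) hs k)
      refine tendsto_const_nhds.congr' ?_
      filter_upwards [eventually_ge_atTop (T k)] with t ht
      simp [not_lt.2 ht]
    have h₂ := (tendsto_pow_atTop_nhds_zero_of_lt_one (r := (1 / 2 : ℝ)) (by norm_num)
      (by norm_num)).const_mul s
    simpa using h₁.add h₂

end Comparison

/-- A bounded quantity `y` that is small for small `s` and `v`, and for small `v` and large `t`,
has a bound `β(s, t) + γ(v)` with `β` of class `𝒦ℒ` and `γ` of class `𝒦`. -/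
lemma exists_comparison_bound (Z : ℝ → ℕ → ℝ → ℝ → Prop) {M : ℝ}
    (hZ : ∀ s t v y, Z s t v y → 0 ≤ s ∧ 0 ≤ v ∧ y ≤ M)
    (hstable : ∀ ε > 0, ∃ δ > 0, ∀ s t v y, Z s t v y → s ≤ δ → v ≤ δ → y ≤ ε)
    (hattr : ∀ ε > 0, ∃ δ > 0, ∃ T, ∀ s t v y, Z s t v y → v ≤ δ → T ≤ t → y ≤ ε) :
    ∃ (β : ℝ → ℕ → ℝ) (γ : ℝ → ℝ), IsClassKL β ∧ IsClassK γ ∧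
      ∀ s t v y, Z s t v y → y ≤ β s t + γ v := by
  set L : ℝ := max M 1 with hL
  have hL₀ : 0 < L := lt_max_of_lt_right one_pos
  -- Contrapositive on a dyadic scale: a value above level `k + 1` must be paid for by a large `v`,
  -- or by a large `s` at an early time.
  have hboth : ∀ k : ℕ, ∃ δ > 0, ∃ T, ∀ s t v y, Z s t v y → L * (1 / 2) ^ (k + 1) < y →
      δ ≤ v ∨ (δ ≤ s ∧ t < T) := by
    intro k
    obtain ⟨δ₁, hδ₁, h₁⟩ := hstable (L * (1 / 2) ^ (k + 1)) (by positivity)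
    obtain ⟨δ₂, hδ₂, T, h₂⟩ := hattr (L * (1 / 2) ^ (k + 1)) (by positivity)
    refine ⟨min δ₁ δ₂, lt_min hδ₁ hδ₂, T, fun s t v y hz hy => ?_⟩
    by_contra! hcon
    obtain ⟨hv, hst⟩ := hcon
    have hv₁ := hv.le.trans (min_le_left _ _)
    have hv₂ := hv.le.trans (min_le_right _ _)
    rcases le_or_gt (min δ₁ δ₂) s with hs | hs
    · exact (h₂ s t v y hz hv₂ (hst hs)).not_gt hy
    · exact (h₁ s t v y hz (hs.le.trans (min_le_left _ _)) hv₁).not_gt hy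
  choose δ hδ T hT using hboth
  have hγ := isClassK_saturatedSeries_add (c := fun _ => 1) hL₀.le hδ (fun _ => zero_le_one)
    (fun _ => le_rfl) one_pos
  have hβ := isClassKL_saturatedSeries_add hL₀.le hδ T
  refine ⟨_, _, hβ, hγ, fun s t v y hz => ?_⟩
  obtain ⟨hs, hv, hy⟩ := hZ s t v y hz
  have hc : ∀ k, (0 : ℝ) ≤ if t < T k then 1 else 0 := fun k => by split_ifs <;> norm_num
  have hc₁ : ∀ k, (if t < T k then 1 else 0 : ℝ) ≤ 1 := fun k => by split_ifs <;> norm_num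
  have hβ₀ := saturatedSeries_nonneg hL₀.le hδ hc hs
  have hγ₀ := saturatedSeries_nonneg (c := fun _ => 1) hL₀.le hδ (fun _ => zero_le_one) hv
  have hs₂ : 0 ≤ s * (1 / 2) ^ t := by positivity
  rcases le_or_gt y 0 with hy₀ | hy₀
  · linarith
  -- Choose `k` with `L 2⁻⁽ᵏ⁺¹⁾ < y ≤ L 2⁻ᵏ`; the saturated `k`-th term of `γ` or `β` alone then
  -- dominates `y`.
  obtain ⟨k, hk, hk'⟩ := exists_nat_pow_near_of_lt_one (y := (1 / 2 : ℝ)) (div_pos hy₀ hL₀)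
    ((div_le_one hL₀).2 (hy.trans (le_max_left _ _))) (by norm_num) (by norm_num)
  rw [lt_div_iff₀' hL₀] at hk
  rw [div_le_iff₀' hL₀] at hk'
  rcases hT k s t v y hz hk with h | ⟨h, ht⟩
  · have := le_saturatedSeries (c := fun _ => 1) hL₀.le hδ (fun _ => zero_le_one)
      (fun _ => le_rfl) h rfl
    linarith
  · have := le_saturatedSeries hL₀.le hδ hc hc₁ h (if_pos ht)
    linarith

/-- If `0` is asymptotically stable for the uniformly continuous map `F` on the bounded invariant
set `X₀`, then the trajectories in `X₀` of `x⁺ = F x + e` satisfy an ISS estimate. -/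
lemma exists_iss_bound_of_uniformContinuousOn {E : Type*} [NormedAddCommGroup E] {X₀ : Set E}
    (hX₀ : Bornology.IsBounded X₀) {F : E → E} (hF : UniformContinuousOn F X₀)
    (hmaps : Set.MapsTo F X₀ X₀) {β : ℝ → ℕ → ℝ} (hβ : IsClassKL β)
    (hstab : ∀ x ∈ X₀, ∀ t, ‖F^[t] x‖ ≤ β ‖x‖ t) (C : ℝ) :
    ∃ (β' : ℝ → ℕ → ℝ) (γ : ℝ → ℝ), IsClassKL β' ∧ IsClassK γ ∧
      ∀ x : ℕ → E, (∀ t, x t ∈ X₀) → ∀ t, ∀ v ≥ 0,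
        (∀ k < t, ‖x (k + 1) - F (x k)‖ ≤ C * v) → ‖x t‖ ≤ β' ‖x 0‖ t + γ v := by
  obtain ⟨M, hM₀, hM⟩ := hX₀.exists_pos_norm_le
  have hsmall : ∀ η > 0, ∃ δ > 0, ∀ v ≤ δ, 0 ≤ v → C * v ≤ η := fun η hη =>
    ⟨η / (|C| + 1), by positivity, fun v hv hv₀ => by
      rw [le_div_iff₀' (by positivity)] at hv
      nlinarith [le_abs_self C]⟩
  have hattr : ∀ ε > 0, ∃ δ > 0, ∃ T, ∀ x : ℕ → E, (∀ t, x t ∈ X₀) → ∀ t, ∀ v ≥ 0,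
      (∀ k < t, ‖x (k + 1) - F (x k)‖ ≤ C * v) → v ≤ δ → T ≤ t → ‖x t‖ ≤ ε := by
    intro ε hε
    obtain ⟨T, hT⟩ := ((hβ.tendsto M hM₀.le).eventually (gt_mem_nhds (half_pos hε))).exists
    obtain ⟨η, hη, hclose⟩ := exists_norm_sub_iterate_le hF hmaps T (ε / 2) (half_pos hε)
    obtain ⟨δ, hδ, hCδ⟩ := hsmall η hη
    refine ⟨δ, hδ, T, fun x hx t v hv he hvδ hTt => ?_⟩
    -- Restart at `t - T`: only the last `T` perturbations matter, and `β M T` bounds the iterate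
    -- whatever the restart state.
    have h₁ := hclose (fun k => x (t - T + k)) (fun k => hx _) T le_rfl fun k hk =>
      (he (t - T + k) (by omega)).trans (hCδ v hvδ hv)
    have h₂ := hstab _ (hx (t - T)) T
    have h₃ : β ‖x (t - T)‖ T ≤ β M T :=
      (hβ.classK T).strictMonoOn.monotoneOn (norm_nonneg _) hM₀.le (hM _ (hx _))
    simp only [Nat.sub_add_cancel hTt, add_zero] at h₁
    have h₄ := norm_le_norm_add_norm_sub' (x t) (F^[T] (x (t - T)))
    linarith
  have hstable : ∀ ε > 0, ∃ δ > 0, ∀ x : ℕ → E, (∀ t, x t ∈ X₀) → ∀ t, ∀ v ≥ 0,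
      (∀ k < t, ‖x (k + 1) - F (x k)‖ ≤ C * v) → ‖x 0‖ ≤ δ → v ≤ δ → ‖x t‖ ≤ ε := by
    intro ε hε
    obtain ⟨δ₁, hδ₁, T, hT⟩ := hattr ε hε
    obtain ⟨η, hη, hclose⟩ := exists_norm_sub_iterate_le hF hmaps T (ε / 2) (half_pos hε)
    obtain ⟨δ₂, hδ₂, hCδ⟩ := hsmall η hη
    obtain ⟨δ₃, hδ₃, hβδ⟩ := Metric.continuousWithinAt_iff.1
      ((hβ.classK 0).continuousOn 0 Set.self_mem_Ici) (ε / 2) (half_pos hε)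
    refine ⟨min δ₁ (min δ₂ (δ₃ / 2)), by positivity, fun x hx t v hv he hx₀ hvδ => ?_⟩
    rw [le_min_iff, le_min_iff] at hx₀ hvδ
    rcases le_total T t with hTt | hTt
    -- Late times are covered by attractivity, so closeness to the iterates is needed only up to
    -- `T`.
    · exact hT x hx t v hv he hvδ.1 hTt
    have h₁ := hclose x hx t hTt fun k hk => (he k hk).trans (hCδ v hvδ.2.1 hv)
    have h₂ := hstab _ (hx 0) t
    have h₃ : β ‖x 0‖ t ≤ β ‖x 0‖ 0 := hβ.antitone _ (norm_nonneg _) t.zero_le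
    have h₄ := hβδ (norm_nonneg (x 0)) (by
      rw [dist_zero_right, norm_norm]
      linarith [hx₀.2.2])
    rw [(hβ.classK 0).map_zero, dist_zero_right, Real.norm_eq_abs] at h₄
    have h₅ := norm_le_norm_add_norm_sub' (x t) (F^[t] (x 0))
    linarith [le_abs_self (β ‖x 0‖ 0)]
  obtain ⟨β', γ, hβ', hγ, h⟩ := exists_comparison_bound
    (fun s t v y => 0 ≤ v ∧ ∃ x : ℕ → E, (∀ t, x t ∈ X₀) ∧
      (∀ k < t, ‖x (k + 1) - F (x k)‖ ≤ C * v) ∧ s = ‖x 0‖ ∧ y = ‖x t‖) (M := M)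
    (by
      rintro s t v y ⟨hv, x, hx, -, rfl, rfl⟩
      exact ⟨norm_nonneg _, hv, hM _ (hx _)⟩)
    (fun ε hε => by
      obtain ⟨δ, hδ, h⟩ := hstable ε hε
      refine ⟨δ, hδ, ?_⟩
      rintro s t v y ⟨hv, x, hx, he, rfl, rfl⟩
      exact h x hx t v hv he)
    (fun ε hε => by
      obtain ⟨δ, hδ, T, h⟩ := hattr ε hε
      refine ⟨δ, hδ, T, ?_⟩
      rintro s t v y ⟨hv, x, hx, he, rfl, rfl⟩
      exact h x hx t v hv he)
  exact ⟨β', γ, hβ', hγ, fun x hx t v hv he => h _ t v _ ⟨hv, x, hx, he, rfl, rfl⟩⟩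

/-! ### Invariance and the perturbation form of the safe closed loop -/

section ClosedLoop

variable {n m q : ℕ} {S : LinSys n m q} {X : Set (Vec n)} {U : Set (Vec m)} {W : Set (Vec q)}
  {X₀ : Set (Vec n)} {P : SMPC n m q} {b : BackupMPC n m}

lemma SafeInput.step_mem (hinv : ∀ x ∈ X₀, ∀ w ∈ W, S.step x (b.law x) w ∈ X₀) {x : Vec n}
    {u : Vec m} {w : Vec q} (hu : SafeInput S X U W X₀ P b x u) (hx : x ∈ X₀) (hw : w ∈ W) :
    S.step x u w ∈ X₀ := by
  rcases hu with ⟨V, -, htest, rfl⟩ | ⟨-, rfl⟩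
  · exact htest _ ⟨w, hw, rfl⟩
  · exact hinv x hx w hw

lemma IsSafeRun.mem (hinv : ∀ x ∈ X₀, ∀ w ∈ W, S.step x (b.law x) w ∈ X₀) {x : ℕ → Vec n}
    {u : ℕ → Vec m} {w : ℕ → Vec q} (h : IsSafeRun S X U W X₀ P b x u w) (h₀ : x 0 ∈ X₀)
    (t : ℕ) : x t ∈ X₀ := by
  induction t with
  | zero => exact h₀
  | succ t ih =>
    obtain ⟨hw, hu, hstep⟩ := h t
    exact hstep ▸ hu.step_mem hinv ih hw

lemma step_sub_step_zero (S : LinSys n m q) (x : Vec n) (u u' : Vec m) (w : Vec q) :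
    S.step x u w - S.step x u' 0 = S.G.toEuclideanLin w - S.B.toEuclideanLin (u' - u) := by
  simp only [LinSys.step, map_zero, map_sub]
  abel

lemma exists_norm_step_sub_step_zero_le (S : LinSys n m q) :
    ∃ C, ∀ (x : Vec n) (u u' : Vec m) (w : Vec q),
      ‖S.step x u w - S.step x u' 0‖ ≤ C * ‖WithLp.toLp 2 (u' - u, w)‖ := by
  let B := LinearMap.toContinuousLinearMap S.B.toEuclideanLin
  let G := LinearMap.toContinuousLinearMap S.G.toEuclideanLin
  refine ⟨‖G‖ + ‖B‖, fun x u u' w => ?_⟩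
  have hB : ‖u' - u‖ ≤ ‖WithLp.toLp 2 (u' - u, w)‖ :=
    WithLp.norm_fst_le _ (WithLp.toLp 2 (u' - u, w))
  have hG : ‖w‖ ≤ ‖WithLp.toLp 2 (u' - u, w)‖ :=
    WithLp.norm_snd_le _ (WithLp.toLp 2 (u' - u, w))
  rw [step_sub_step_zero, add_mul]
  exact (norm_sub_le _ _).trans (add_le_add
    ((G.le_opNorm w).trans (by gcongr)) ((B.le_opNorm (u' - u)).trans (by gcongr)))

end ClosedLoop

end SafeSMPC

theorem theorem3 {n m q : ℕ} (S : SafeSMPC.LinSys n m q)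
    (X : Set (SafeSMPC.Vec n)) (U : Set (SafeSMPC.Vec m)) (W : Set (SafeSMPC.Vec q))
    (X₀ : Set (SafeSMPC.Vec n))
    (P : SafeSMPC.SMPC n m q) (b : SafeSMPC.BackupMPC n m)
    -- bounded uncertainty
    (hW : Bornology.IsBounded W) (hW0 : 0 ∈ W)
    -- backup MPC
    (hb : b.Admissible S X U W X₀)
    (hX₀ : Bornology.IsBounded X₀) (hκ : UniformContinuousOn b.law X₀)
    -- backup MPC cost
    (Q : Matrix (Fin n) (Fin n) ℝ) (R : Matrix (Fin m) (Fin m) ℝ)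
    (K : Matrix (Fin m) (Fin n) ℝ) (Xf : Set (SafeSMPC.Vec n)) (Vf : SafeSMPC.Vec n → ℝ)
    (hQ : Q.PosDef) (hR : R.PosDef) (hK : SafeSMPC.IsStabilizing S K)
    (hVf : SafeSMPC.IsTerminalLyapunov S Q R K Xf Vf)
    (hJ : b.HasQuadraticCost S Q R Vf) :
    (∀ x u w, SafeSMPC.IsSafeRun S X U W X₀ P b x u w → x 0 ∈ X₀ → ∀ t, x t ∈ X₀) ∧
    SafeSMPC.IsISS X₀ (SafeSMPC.safeClosedLoop S X U W X₀ P b) := by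
  open SafeSMPC in
  refine ⟨fun x u w h h₀ => h.mem hb.invariant h₀, hb.iss.1, ?_⟩
  obtain ⟨-, β, γ, hβ, hγ, hiss⟩ := hb.iss
  obtain ⟨C, hC⟩ := exists_norm_step_sub_step_zero_le S
  set F : Vec n → Vec n := fun x => S.step x (b.law x) 0 with hFdef
  have hmaps : Set.MapsTo F X₀ X₀ := fun x hx => hb.invariant x hx 0 hW0
  have hF : UniformContinuousOn F X₀ := by
    have hA := (LinearMap.toContinuousLinearMap S.A.toEuclideanLin).uniformContinuous
    have hB := (LinearMap.toContinuousLinearMap S.B.toEuclideanLin).uniformContinuous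
    rw [uniformContinuousOn_iff_restrict] at hκ ⊢
    refine ((hA.comp uniformContinuous_subtype_val).add (hB.comp hκ)).congr fun x => ?_
    simp [hFdef, LinSys.step]
  have hstab : ∀ x ∈ X₀, ∀ t, ‖F^[t] x‖ ≤ β ‖x‖ t := by
    intro x hx t
    -- The iterates of `F` form a backup trajectory with zero disturbance, for which the gain term
    -- vanishes.
    have h := hiss (fun k => F^[k] x) (fun _ => 0)
      (fun k => ⟨hW0, Function.iterate_succ_apply' F k x⟩) hx t
    have hsup : ((Finset.range t).sup fun _ => ‖(0 : Vec q)‖₊) = 0 := by simp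
    rwa [hsup, NNReal.coe_zero, hγ.map_zero, add_zero] at h
  obtain ⟨β', γ', hβ', hγ', hbound⟩ :=
    -- `max C 0` makes the constant nonnegative, so the bound is monotone in the disturbance norm
    -- and passes to its running maximum.
    exists_iss_bound_of_uniformContinuousOn hX₀ hF hmaps hβ hstab (max C 0)
  refine ⟨β', γ', hβ', hγ', ?_⟩
  rintro x d ⟨u, w, hrun, hd⟩ h₀ t
  refine hbound x (hrun.mem hb.invariant h₀) t _ (NNReal.coe_nonneg _) fun k hk => ?_
  have hdk : ‖d k‖ ≤ (((Finset.range t).sup fun k => ‖d k‖₊ : NNReal) : ℝ) :=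
    NNReal.coe_le_coe.2 (Finset.le_sup (f := fun k => ‖d k‖₊) (Finset.mem_range.2 hk))
  have hCk : ‖x (k + 1) - F (x k)‖ ≤ C * ‖d k‖ := by
    have hdk' : d k = extDist b x u w k := congrFun hd k
    have hstep : x (k + 1) = S.step (x k) (u k) (w k) := (hrun k).2.2
    rw [hstep, hdk']
    exact hC _ _ _ _
  calc _ ≤ C * ‖d k‖ := hCk
    _ ≤ max C 0 * ‖d k‖ := by gcongr; exact le_max_left _ _
    _ ≤ _ := by gcongr
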